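/- Let $A,B:\mathbb R^n\rightrightarrows\mathbb R^n$ be set-valued operators with graphs $\operatorname{gph}A,\operatorname{gph}B$. Write $[a]_-=\min\{0,a\}$ and, for reals with $a=b=0$ or $a+b\neq 0$, let $a\,\square\,b=0$ if $a=b=0$ and $a\,\square\,b=\frac{ab}{a+b}$ otherwise. $A$ is $(\mu,\rho)$-semimonotone at $(x',y')\in\operatorname{gph}A$ if $\langle x-x',y-y'\rangle\ge\mu\|x-x'\|^2+\rho\|y-y'\|^2$ for all $(x,y)\in\operatorname{gph}A$; it is $(\mu,\rho)$-semimonotone if this holds at every $(x',y')\in\operatorname{gph}A$, and maximally so if moreover its graph is not strictly contained in the graph of another $(\mu,\rho)$-semimonotone operator. Let $J_{\gamma A}=(\mathrm{id}+\gamma A)^{-1}$, let $T_{\rm PD}(x,y)=(Ax+y)\times(B^{-1}y-x)$, and let $\operatorname{zer}T_{\rm PD}=\{z: 0\in T_{\rm PD}z\}$, so that $(x^\star,y^\star)\in\operatorname{zer}T_{\rm PD}$ if and only if $-y^\star\in Ax^\star$ and $y^\star\in Bx^\star$. **Assumptions.** $A$ and $B$ are outer semicontinuous (i.e. have closed graphs).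 There are $\mu_A,\rho_A,\mu_B,\rho_B\in\mathbb R$ and a nonempty set $\mathcal S^\star\subseteq\operatorname{zer}T_{\rm PD}$ such that * either $\mu_A+\mu_B>0$ or $\mu_A=\mu_B=0$; either $\rho_A+\rho_B>0$ or $\rho_A=\rho_B=0$; and $[\mu_A\square\mu_B]_-\,[\rho_A\square\rho_B]_-<\frac14$; * for every $(x^\star,y^\star)\in\mathcal S^\star$, $A$ is $(\mu_A,\rho_A)$-semimonotone at $(x^\star,-y^\star)$ and $B$ is $(\mu_B,\rho_B)$-semimonotone at $(x^\star,y^\star)$. With $\mu=\mu_A\square\mu_B$, $\rho=\rho_A\square\rho_B$, $\gamma_-=-\frac{2\rho}{1+\sqrt{1-4\mu\rho}}$ and $\gamma_+=-\frac{1+\sqrt{1-4\mu\rho}}{2\mu}$, let $\gamma$ lie in the interval given by the following table. | | $\mu_A=\mu_B=0$ | $\mu_A+\mu_B>0$, $\mu_A\mu_B\ge0$ | $\mu_A+\mu_B>0$, $\mu_A\mu_B<0$ | |---|---|---|---| | $\rho_A=\rho_B=0$ | $(0,\infty)$ | $(0,\infty)$ | $(0,-\frac1\mu)$ | | $\rho_A+\rho_B>0$,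 $\rho_A\rho_B\ge0$ | $(0,\infty)$ | $(0,\infty)$ | $(0,\gamma_+)$ | | $\rho_A+\rho_B>0$, $\rho_A\rho_B<0$ | $(-\rho,\infty)$ | $(\gamma_-,\infty)$ | $(\gamma_-,\gamma_+)$ | Finally, suppose that either (i) $J_{\gamma A}$ and $J_{\gamma B}$ have full domain, or (ii) $A$ is maximally $(\mu_A,\rho_A)$-semimonotone and $B$ is maximally $(\mu_B,\rho_B)$-semimonotone. **Theorem.** Then $\alpha:=1+\frac1\gamma\rho+\gamma\mu>0$. Moreover, let $(u^k,v^k,s^k)_{k\in\mathbb N}$ be a sequence generated from some $s^0\in\mathbb R^n$ by Douglas-Rachford splitting, $$u^k\in J_{\gamma A}(s^k),\qquad v^k\in J_{\gamma B}(2u^k-s^k),\qquad s^{k+1}=s^k+\lambda_k(v^k-u^k),$$ with $\lambda_k\in(0,2\alpha)$ and $\liminf_{k\to\infty}\lambda_k(2\alpha-\lambda_k)>0$, and put $z^k=\bigl(u^k,\frac1\gamma(2u^k-s^k-v^k)\bigr)$. Then either $z^k\in\operatorname{zer}T_{\rm PD}$ for some $k$, or the following hold. 1. $\gamma^{-1}(u^k-v^k)\in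 Au^k+Bv^k$ for all $k$, and $u^k-v^k\to0$. 2. Every limit point (if any) of $(z^k)$ belongs to $\operatorname{zer}T_{\rm PD}$. 3. $(s^k)$ is bounded. 4. If $\lambda_k(2\alpha-\lambda_k)\ge\kappa>0$ for all $k$, then for all $(x^\star,y^\star)\in\mathcal S^\star$, with $s^\star=x^\star-\gamma y^\star$, and all $N\in\mathbb N$, $$\min_{k=0,\dots,N}\|u^k-v^k\|^2\le\frac{\|s^0-s^\star\|^2}{(N+1)\kappa}.$$ Moreover (whichever alternative occurs), if $J_{\gamma A}$ and $J_{\gamma B}$ are single-valued and continuous on $\mathbb R^n$, the following hold. 5. Every limit point of $(s^k)$ belongs to $\{x^\star-\gamma y^\star : (x^\star,y^\star)\in\operatorname{zer}T_{\rm PD}\}$. 6. If $\mathcal S^\star=\operatorname{zer}T_{\rm PD}$, then $(s^k)$ converges to some element of $\{x^\star-\gamma y^\star : (x^\star,y^\star)\in\operatorname{zer}T_{\rm PD}\}$ and $(z^k)$ converges to some element of $\operatorname{zer}T_{\rm PD}$. -/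

import Mathlib

open Filter Topology Set

/-- A set-valued operator `A : E ⇉ E`. -/
abbrev SetOp (E : Type*) := E → Set E

namespace SetOp

/-- The graph `{(x, y) | y ∈ A x}`. -/
def graph {E : Type*} (A : SetOp E) : Set (E × E) := {p | p.2 ∈ A p.1}

/-- The domain `{x | A x ≠ ∅}`. -/
def dom {E : Type*} (A : SetOp E) : Set E := {x | (A x).Nonempty}

/-- The set of zeros `{x | 0 ∈ A x}`. -/
def zer {E : Type*} [Zero E] (A : SetOp E) : Set E := {x | (0 : E) ∈ A x}

/-- The inverse operator: `x ∈ A⁻¹ y` iff `y ∈ A x`. -/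
def inv {E : Type*} (A : SetOp E) : SetOp E := fun y => {x | y ∈ A x}

/-- The operator `γ A`. -/
def scale {E : Type*} [SMul ℝ E] (γ : ℝ) (A : SetOp E) : SetOp E :=
  fun x => {y | ∃ a ∈ A x, y = γ • a}

/-- The operator `id + A`. -/
def idAdd {E : Type*} [Add E] (A : SetOp E) : SetOp E :=
  fun x => {y | ∃ a ∈ A x, y = x + a}

/-- The resolvent `J_A = (id + A)⁻¹`. -/
def resolvent {E : Type*} [Add E] (A : SetOp E) : SetOp E := (idAdd A).inv

/-- Outer semicontinuity of `A` at every point `x`: all limits of sequences `y k ∈ A (x k)` with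
`x k → x` belong to `A x`. It amounts to closedness of the graph. -/
def OuterSemicontinuous {E : Type*} [TopologicalSpace E] (A : SetOp E) : Prop :=
  ∀ (x y : E) (xs ys : ℕ → E), Tendsto xs atTop (𝓝 x) → Tendsto ys atTop (𝓝 y) →
    (∀ k, ys k ∈ A (xs k)) → y ∈ A x

/-- `A` is single-valued (with full domain) and continuous. -/
def SingleValuedContinuous {E : Type*} [TopologicalSpace E] (A : SetOp E) : Prop :=
  ∃ f : E → E, Continuous f ∧ ∀ x, A x = {f x}

section Semimonotone

variable {E : Type*} [NormedAddCommGroup E] [InnerProductSpace ℝ E]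

/-- `(μ, ρ)`-semimonotonicity of `A` at `(x', y') ∈ gph A`. -/
def SemimonotoneAt (A : SetOp E) (μ ρ : ℝ) (x' y' : E) : Prop :=
  (x', y') ∈ A.graph ∧
    ∀ x y : E, (x, y) ∈ A.graph →
      μ * ‖x - x'‖ ^ 2 + ρ * ‖y - y'‖ ^ 2 ≤ inner ℝ (x - x') (y - y')

/-- `(μ, ρ)`-semimonotonicity of `A`: semimonotonicity at every point of the graph. -/
def Semimonotone (A : SetOp E) (μ ρ : ℝ) : Prop :=
  ∀ x' y' : E, (x', y') ∈ A.graph → A.SemimonotoneAt μ ρ x' y'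

/-- Maximal `(μ, ρ)`-semimonotonicity: `A` is `(μ, ρ)`-semimonotone and its graph is not strictly
contained in the graph of another `(μ, ρ)`-semimonotone operator. -/
def MaximallySemimonotone (A : SetOp E) (μ ρ : ℝ) : Prop :=
  A.Semimonotone μ ρ ∧ ∀ A' : SetOp E, A'.Semimonotone μ ρ → ¬ A.graph ⊂ A'.graph

end Semimonotone

/-- The primal-dual operator `T_PD (x, y) = (A x + y) × (B⁻¹ y - x)`. -/
def primalDual {E : Type*} [AddGroup E] (A B : SetOp E) : SetOp (E × E) :=
  fun z => {w | ∃ a ∈ A z.1, ∃ b ∈ B.inv z.2, w = (a + z.2, b - z.1)}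

end SetOp

noncomputable section

/-- The parallel sum `a □ b` of real numbers (used for `a = b = 0` or `a + b ≠ 0` only). -/
def parSum (a b : ℝ) : ℝ := if a = 0 ∧ b = 0 then 0 else a * b / (a + b)

/-- The negative part `[a]₋ = min {0, a}`, which is nonpositive. -/
def negPt (a : ℝ) : ℝ := min 0 a

/-- The bound `γ₋ = -2ρ / (1 + √(1 - 4μρ))`, as a function of `μ = μ_A □ μ_B`, `ρ = ρ_A □ ρ_B`. -/
def gammaMinus (μ ρ : ℝ) : ℝ := -(2 * ρ / (1 + √(1 - 4 * μ * ρ)))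

/-- The bound `γ₊ = -(1 + √(1 - 4μρ)) / (2μ)`, as a function of `μ = μ_A □ μ_B`,
`ρ = ρ_A □ ρ_B`. -/
def gammaPlus (μ ρ : ℝ) : ℝ := -((1 + √(1 - 4 * μ * ρ)) / (2 * μ))

/-- The range of admissible stepsizes `γ`, for parameters such that either `μA = μB = 0` or
`μA + μB > 0`, and either `ρA = ρB = 0` or `ρA + ρB > 0`. -/
def stepsizeRange (μA ρA μB ρB : ℝ) : Set ℝ :=
  if μA = 0 ∧ μB = 0 then
    if ρA = 0 ∧ ρB = 0 then Ioi 0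
    else if 0 ≤ ρA * ρB then Ioi 0
    else Ioi (-(parSum ρA ρB))
  else if 0 ≤ μA * μB then
    if ρA = 0 ∧ ρB = 0 then Ioi 0
    else if 0 ≤ ρA * ρB then Ioi 0
    else Ioi (gammaMinus (parSum μA μB) (parSum ρA ρB))
  else
    if ρA = 0 ∧ ρB = 0 then Ioo 0 (-(1 / parSum μA μB))
    else if 0 ≤ ρA * ρB then Ioo 0 (gammaPlus (parSum μA μB) (parSum ρA ρB))
    else Ioo (gammaMinus (parSum μA μB) (parSum ρA ρB)) (gammaPlus (parSum μA μB) (parSum ρA ρB))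

/-- The constant `α = 1 + (ρ_A □ ρ_B) / γ + γ (μ_A □ μ_B)`. -/
def drsAlpha (μA ρA μB ρB γ : ℝ) : ℝ := 1 + 1 / γ * parSum ρA ρB + γ * parSum μA μB

end

/-- `A` and `B` are semimonotone, with parameters satisfying the stated sign conditions, at every
point of a nonempty set `S` of primal-dual solutions. -/
structure SemimonotoneAtSolutions {E : Type*} [NormedAddCommGroup E] [InnerProductSpace ℝ E]
    (A B : SetOp E) (μA ρA μB ρB : ℝ) (S : Set (E × E)) : Prop where
  nonempty : S.Nonempty
  subset_zer : S ⊆ (SetOp.primalDual A B).zer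
  mu_cond : 0 < μA + μB ∨ (μA = 0 ∧ μB = 0)
  rho_cond : 0 < ρA + ρB ∨ (ρA = 0 ∧ ρB = 0)
  prod_cond : negPt (parSum μA μB) * negPt (parSum ρA ρB) < 1 / 4
  semi_A : ∀ z ∈ S, A.SemimonotoneAt μA ρA z.1 (-z.2)
  semi_B : ∀ z ∈ S, B.SemimonotoneAt μB ρB z.1 z.2

/-- `(u k, v k, s k)` is generated by (relaxed) Douglas-Rachford splitting with stepsize `γ` and
relaxation parameters `lam k`, starting from `s 0`. -/
structure IsDRSSequence {E : Type*} [NormedAddCommGroup E] [InnerProductSpace ℝ E]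
    (A B : SetOp E) (γ : ℝ) (lam : ℕ → ℝ) (u v s : ℕ → E) : Prop where
  u_mem : ∀ k, u k ∈ (A.scale γ).resolvent (s k)
  v_mem : ∀ k, v k ∈ (B.scale γ).resolvent ((2 : ℝ) • u k - s k)
  s_succ : ∀ k, s (k + 1) = s k + lam k • (v k - u k)

/-- The primal-dual point `(u, γ⁻¹ (2u - s - v))` attached to an iterate `(u, v, s)`. -/
noncomputable def drsPoint {E : Type*} [NormedAddCommGroup E] [InnerProductSpace ℝ E]
    (γ : ℝ) (u v s : E) : E × E :=
  (u, γ⁻¹ • ((2 : ℝ) • u - s - v))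

/-!
Fix `(x⋆, y⋆) ∈ S`, put `s⋆ = x⋆ - γ y⋆`, and let `u, v` be the resolvent values computed from `s`,
so that `a = (s - u) / γ ∈ A u`, `b = (2 u - s - v) / γ ∈ B v` and `a + b = (u - v) / γ`. Expanding
inner products gives the identity (`inner_shadow_sub_eq`)
`⟪s - s⋆, u - v⟫ = ‖u - v‖² + γ (⟪u - x⋆, a + y⋆⟫ + ⟪v - x⋆, b - y⋆⟫)`.
Semimonotonicity of `A` at `(x⋆, -y⋆)` and of `B` at `(x⋆, y⋆)` bounds the two inner products from
below by weighted squares, and the weights combine through the parallel sum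
(`parSum_mul_norm_sub_sq_le`): `(a □ b) ‖p - q‖² ≤ a ‖p‖² + b ‖q‖²`. The result is
`α ‖u - v‖² ≤ ⟪s - s⋆, u - v⟫` (`drsAlpha_mul_le_inner`), an oblique cocoercivity at `s⋆`, which for
the relaxed step `s⁺ = s + λ (v - u)` says (`IsDRSSequence.fejer`)
`‖s⁺ - s⋆‖² ≤ ‖s - s⋆‖² - λ (2 α - λ) ‖u - v‖²`.

That `α > 0` is a discussion of the signs of the quadratic polynomial `μ γ² + γ + ρ = γ α`, whose
relevant roots are `γ₋` and `γ₊` (`pos_of_mem_stepsizeRange`).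

Everything else follows from this Fejér-type inequality. It bounds `s`; it forces `u - v → 0`
because `‖s - s⋆‖²` is a convergent sequence whose decrements dominate a multiple of `‖u - v‖²`;
summing it gives the rate; and closedness of the two graphs identifies the cluster points. If the
resolvents are continuous then `u` and `v` are continuous functions of `s`, so that cluster points
of `s` come from zeros; if every zero belongs to `S`, then the distance from `s` to the cluster point
is nonincreasing, hence tends to `0`. The estimates never use that the current iterate is not a
solution, so the asymptotic conclusions hold also when a solution is reached in finitely many steps.
-/

/-! ### Stepsizes and the constant `α` -/

lemma parSum_neg_of_mul_neg {a b : ℝ} (h : 0 < a + b) (hab : a * b < 0) : parSum a b < 0 := by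
  have h0 : ¬(a = 0 ∧ b = 0) := by rintro ⟨rfl, rfl⟩; simp at h
  rw [parSum, if_neg h0]
  exact div_neg_of_neg_of_pos hab h

lemma parSum_nonneg_of_mul_nonneg {a b : ℝ} (h : 0 < a + b) (hab : 0 ≤ a * b) :
    0 ≤ parSum a b := by
  have h0 : ¬(a = 0 ∧ b = 0) := by rintro ⟨rfl, rfl⟩; simp at h
  rw [parSum, if_neg h0]
  exact div_nonneg hab h.le

lemma quadratic_gammaMinus {μ ρ : ℝ} (h : 0 ≤ 1 - 4 * μ * ρ) :
    μ * gammaMinus μ ρ ^ 2 + gammaMinus μ ρ + ρ = 0 := by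
  have hr := Real.sq_sqrt h
  have hr0 := Real.sqrt_nonneg (1 - 4 * μ * ρ)
  unfold gammaMinus
  set r := √(1 - 4 * μ * ρ)
  have : 1 + r ≠ 0 := by positivity
  field_simp
  linear_combination ρ * hr

lemma quadratic_gammaPlus {μ ρ : ℝ} (hμ : μ ≠ 0) (h : 0 ≤ 1 - 4 * μ * ρ) :
    μ * gammaPlus μ ρ ^ 2 + gammaPlus μ ρ + ρ = 0 := by
  have hr := Real.sq_sqrt h
  unfold gammaPlus
  set r := √(1 - 4 * μ * ρ)
  field_simp
  linear_combination hr

lemma gammaMinus_pos {μ ρ : ℝ} (hρ : ρ < 0) : 0 < gammaMinus μ ρ := by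
  have hr0 := Real.sqrt_nonneg (1 - 4 * μ * ρ)
  rw [gammaMinus, neg_pos]
  exact div_neg_of_neg_of_pos (by linarith) (by linarith)

/-- A concave quadratic polynomial is positive strictly between a point where it is nonnegative and
a point where it vanishes. -/
lemma quadratic_pos_of_mem_Ioo {μ ρ a b x : ℝ} (hμ : μ < 0) (ha : 0 ≤ μ * a ^ 2 + a + ρ)
    (hb : μ * b ^ 2 + b + ρ = 0) (hax : a < x) (hxb : x < b) : 0 < μ * x ^ 2 + x + ρ := by
  have hba : 0 < b - a := by linarith
  -- Lagrange interpolation at `a` and `b`, with the second-order remainder.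
  have key : (b - a) * (μ * x ^ 2 + x + ρ) = (b - x) * (μ * a ^ 2 + a + ρ)
      + (x - a) * (μ * b ^ 2 + b + ρ) + -μ * ((x - a) * (b - x) * (b - a)) := by ring
  have h1 : 0 < -μ * ((x - a) * (b - x) * (b - a)) :=
    mul_pos (by linarith) (mul_pos (mul_pos (by linarith) (by linarith)) hba)
  have h2 : 0 ≤ (b - x) * (μ * a ^ 2 + a + ρ) := mul_nonneg (by linarith) ha
  rw [hb, mul_zero, add_zero] at key
  exact pos_of_mul_pos_right (by linarith : 0 < (b - a) * (μ * x ^ 2 + x + ρ)) hba.le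

/-- Admissible stepsizes are positive, and they make the quadratic polynomial `γ α` positive. -/
lemma quadratic_pos_of_mem_stepsizeRange {μA ρA μB ρB γ : ℝ}
    (hμ : 0 < μA + μB ∨ (μA = 0 ∧ μB = 0)) (hρ : 0 < ρA + ρB ∨ (ρA = 0 ∧ ρB = 0))
    (hprod : negPt (parSum μA μB) * negPt (parSum ρA ρB) < 1 / 4)
    (hγ : γ ∈ stepsizeRange μA ρA μB ρB) :
    0 < γ ∧ 0 < parSum μA μB * γ ^ 2 + γ + parSum ρA ρB := by
  have zero_eq {a b : ℝ} (h : a = 0 ∧ b = 0) : parSum a b = 0 := if_pos h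
  unfold stepsizeRange at hγ
  split_ifs at hγ with h1 h2 h3 h4 h5 h6 h7 h8 <;>
    simp only [mem_Ioi, mem_Ioo] at hγ
  · rw [zero_eq h1, zero_eq h2]
    constructor <;> linarith
  · have := parSum_nonneg_of_mul_nonneg (hρ.resolve_right h2) h3
    rw [zero_eq h1]
    constructor <;> linarith
  · have := parSum_neg_of_mul_neg (hρ.resolve_right h2) (not_le.1 h3)
    rw [zero_eq h1]
    constructor <;> linarith
  · have := parSum_nonneg_of_mul_nonneg (hμ.resolve_right h1) h4
    rw [zero_eq h5]
    exact ⟨hγ, by positivity⟩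
  · have := parSum_nonneg_of_mul_nonneg (hμ.resolve_right h1) h4
    have := parSum_nonneg_of_mul_nonneg (hρ.resolve_right h5) h6
    exact ⟨hγ, by positivity⟩
  · have hm := parSum_nonneg_of_mul_nonneg (hμ.resolve_right h1) h4
    have hr := parSum_neg_of_mul_neg (hρ.resolve_right h5) (not_le.1 h6)
    have hg := gammaMinus_pos (μ := parSum μA μB) hr
    have hq := quadratic_gammaMinus (μ := parSum μA μB) (ρ := parSum ρA ρB) (by nlinarith)
    have hsq : parSum μA μB * gammaMinus (parSum μA μB) (parSum ρA ρB) ^ 2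
        ≤ parSum μA μB * γ ^ 2 := by gcongr
    exact ⟨hg.trans hγ, by linarith⟩
  · have hm := parSum_neg_of_mul_neg (hμ.resolve_right h1) (not_le.1 h4)
    rw [zero_eq h7]
    exact ⟨hγ.1, quadratic_pos_of_mem_Ioo hm (a := 0) (by simp)
      (by field_simp; ring) hγ.1 hγ.2⟩
  · have hm := parSum_neg_of_mul_neg (hμ.resolve_right h1) (not_le.1 h4)
    have hr := parSum_nonneg_of_mul_nonneg (hρ.resolve_right h7) h8
    exact ⟨hγ.1, quadratic_pos_of_mem_Ioo hm (a := 0) (by simpa using hr)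
      (quadratic_gammaPlus hm.ne (by nlinarith)) hγ.1 hγ.2⟩
  · have hm := parSum_neg_of_mul_neg (hμ.resolve_right h1) (not_le.1 h4)
    have hr := parSum_neg_of_mul_neg (hρ.resolve_right h7) (not_le.1 h8)
    rw [negPt, negPt, min_eq_right hm.le, min_eq_right hr.le] at hprod
    have hd : 0 ≤ 1 - 4 * parSum μA μB * parSum ρA ρB := by linarith
    exact ⟨(gammaMinus_pos hr).trans hγ.1, quadratic_pos_of_mem_Ioo hm
      (quadratic_gammaMinus hd).ge (quadratic_gammaPlus hm.ne hd) hγ.1 hγ.2⟩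

lemma pos_of_mem_stepsizeRange {μA ρA μB ρB γ : ℝ}
    (hμ : 0 < μA + μB ∨ (μA = 0 ∧ μB = 0)) (hρ : 0 < ρA + ρB ∨ (ρA = 0 ∧ ρB = 0))
    (hprod : negPt (parSum μA μB) * negPt (parSum ρA ρB) < 1 / 4)
    (hγ : γ ∈ stepsizeRange μA ρA μB ρB) : 0 < γ ∧ 0 < drsAlpha μA ρA μB ρB γ := by
  obtain ⟨h0, hq⟩ := quadratic_pos_of_mem_stepsizeRange hμ hρ hprod hγ
  have : drsAlpha μA ρA μB ρB γ = (parSum μA μB * γ ^ 2 + γ + parSum ρA ρB) / γ := by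
    unfold drsAlpha
    field_simp
    ring
  exact ⟨h0, this ▸ div_pos hq h0⟩

/-! ### Resolvents and primal-dual zeros -/

section Resolvent

variable {E : Type*} [NormedAddCommGroup E] [InnerProductSpace ℝ E]

lemma mem_of_mem_resolvent_scale {A : SetOp E} {γ : ℝ} (hγ : γ ≠ 0) {u s : E}
    (h : u ∈ (A.scale γ).resolvent s) : γ⁻¹ • (s - u) ∈ A u := by
  obtain ⟨_, ⟨a, ha, rfl⟩, rfl⟩ := h
  simpa [smul_smul, hγ] using ha

lemma mem_zer_primalDual {G : Type*} [AddGroup G] {A B : SetOp G} {z : G × G} :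
    z ∈ (SetOp.primalDual A B).zer ↔ -z.2 ∈ A z.1 ∧ z.2 ∈ B z.1 := by
  constructor
  · rintro ⟨a, ha, b, hb, h⟩
    obtain ⟨h1, h2⟩ := Prod.ext_iff.1 h
    rw [← eq_neg_of_add_eq_zero_left h1.symm, ← sub_eq_zero.1 h2.symm]
    refine ⟨?_, hb⟩
    rwa [sub_eq_zero.1 h2.symm]
  · rintro ⟨ha, hb⟩
    exact ⟨_, ha, _, hb, by simp only [neg_add_cancel, sub_self]; rfl⟩

/-! ### The cocoercivity estimate -/

lemma parSum_mul_norm_sub_sq_le {a b : ℝ} (h : 0 < a + b ∨ (a = 0 ∧ b = 0)) (p q : E) :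
    parSum a b * ‖p - q‖ ^ 2 ≤ a * ‖p‖ ^ 2 + b * ‖q‖ ^ 2 := by
  rcases h with h | h
  · have h0 : ¬(a = 0 ∧ b = 0) := by rintro ⟨rfl, rfl⟩; simp at h
    rw [parSum, if_neg h0, div_mul_eq_mul_div, div_le_iff₀ h]
    -- The difference of the two sides, multiplied by `a + b`, is `‖a • p + b • q‖ ^ 2`.
    have key : ‖a • p + b • q‖ ^ 2
        = (a * ‖p‖ ^ 2 + b * ‖q‖ ^ 2) * (a + b) - a * b * ‖p - q‖ ^ 2 := by
      rw [norm_add_sq_real, norm_sub_sq_real, norm_smul, norm_smul, real_inner_smul_left,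
        real_inner_smul_right, mul_pow, mul_pow, Real.norm_eq_abs, Real.norm_eq_abs, sq_abs,
        sq_abs]
      ring
    linarith [sq_nonneg ‖a • p + b • q‖]
  · simp [parSum, h]

/-- With `a + b = (u - v) / γ` for `a = (s - u) / γ` and `b = (2 u - s - v) / γ`, the inner product
of `s - s⋆` with the residual `u - v` splits into the two monotonicity products. -/
lemma inner_shadow_sub_eq {γ : ℝ} (hγ : γ ≠ 0) (x y u v s : E) :
    inner ℝ (s - (x - γ • y)) (u - v) = ‖u - v‖ ^ 2
      + γ * (inner ℝ (u - x) (γ⁻¹ • (s - u) - -y)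
        + inner ℝ (v - x) (γ⁻¹ • ((2 : ℝ) • u - s - v) - y)) := by
  -- Writing `y = γ⁻¹ • w` lets the factor `γ` cancel, and the claim becomes bilinear algebra.
  have hy : y = γ⁻¹ • (γ • y) := by simp [smul_smul, hγ]
  generalize γ • y = w at hy
  subst hy
  rw [← smul_neg, ← smul_sub, ← smul_sub, real_inner_smul_right, real_inner_smul_right, ← mul_add,
    mul_inv_cancel_left₀ hγ, ← real_inner_self_eq_norm_sq, ← sub_eq_zero]
  simp only [inner_sub_left, inner_sub_right, inner_smul_right, inner_neg_right,
    real_inner_comm v u, real_inner_comm s u, real_inner_comm s v, real_inner_comm w u,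
    real_inner_comm w v]
  ring

/-- Cocoercivity of the residual `u - v`, relative to the point `x - γ y`, with constant `α`. The
semimonotonicity bounds are combined through `(u - x) - (v - x) = u - v` and
`(a + y) + (b - y) = γ⁻¹ • (u - v)`. -/
lemma drsAlpha_mul_le_inner {A B : SetOp E} {μA ρA μB ρB γ : ℝ} (hγ : 0 < γ)
    (hμ : 0 < μA + μB ∨ (μA = 0 ∧ μB = 0)) (hρ : 0 < ρA + ρB ∨ (ρA = 0 ∧ ρB = 0))
    {x y u v s : E} (hA : A.SemimonotoneAt μA ρA x (-y)) (hB : B.SemimonotoneAt μB ρB x y)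
    (hu : u ∈ (A.scale γ).resolvent s) (hv : v ∈ (B.scale γ).resolvent ((2 : ℝ) • u - s)) :
    drsAlpha μA ρA μB ρB γ * ‖u - v‖ ^ 2 ≤ inner ℝ (s - (x - γ • y)) (u - v) := by
  have h1 := hA.2 _ _ (mem_of_mem_resolvent_scale hγ.ne' hu)
  have h2 := hB.2 _ _ (mem_of_mem_resolvent_scale hγ.ne' hv)
  have h3 := parSum_mul_norm_sub_sq_le hμ (u - x) (v - x)
  have h4 := parSum_mul_norm_sub_sq_le hρ (γ⁻¹ • (s - u) - -y)
    (-(γ⁻¹ • ((2 : ℝ) • u - s - v) - y))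
  have e3 : u - x - (v - x) = u - v := by abel
  have e4 : γ⁻¹ • (s - u) - -y - -(γ⁻¹ • ((2 : ℝ) • u - s - v) - y) = γ⁻¹ • (u - v) := by
    module
  rw [e3] at h3
  rw [e4, norm_neg, norm_smul, mul_pow, Real.norm_eq_abs, sq_abs] at h4
  rw [inner_shadow_sub_eq hγ.ne']
  have h5 := mul_le_mul_of_nonneg_left (add_le_add (add_le_add h3 h4) (add_le_add h1 h2)) hγ.le
  have e5 : drsAlpha μA ρA μB ρB γ * ‖u - v‖ ^ 2 = ‖u - v‖ ^ 2
      + γ * (parSum μA μB * ‖u - v‖ ^ 2 + parSum ρA ρB * (γ⁻¹ ^ 2 * ‖u - v‖ ^ 2)) := by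
    unfold drsAlpha
    field_simp
    ring
  rw [e5]
  linarith

end Resolvent

/-! ### Consequences of the Fejér-type inequality -/

section Fejer

variable {E : Type*} [NormedAddCommGroup E] [InnerProductSpace ℝ E]
  {A B : SetOp E} {μA ρA μB ρB γ : ℝ} {S : Set (E × E)} {lam : ℕ → ℝ} {u v s : ℕ → E}

namespace IsDRSSequence

/-- The Fejér-type inequality: a step decreases the squared distance to the point `x - γ y` attached
to a solution `(x, y) ∈ S` by a multiple of the squared residual. -/
lemma fejer (h : IsDRSSequence A B γ lam u v s) (hS : SemimonotoneAtSolutions A B μA ρA μB ρB S)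
    (hγ : 0 < γ) {k : ℕ} (hlam : 0 ≤ lam k) {z : E × E} (hz : z ∈ S) :
    ‖s (k + 1) - (z.1 - γ • z.2)‖ ^ 2
        + lam k * (2 * drsAlpha μA ρA μB ρB γ - lam k) * ‖u k - v k‖ ^ 2
      ≤ ‖s k - (z.1 - γ • z.2)‖ ^ 2 := by
  have key := mul_le_mul_of_nonneg_left (drsAlpha_mul_le_inner hγ hS.mu_cond hS.rho_cond
    (hS.semi_A z hz) (hS.semi_B z hz) (h.u_mem k) (h.v_mem k)) hlam
  have e : s (k + 1) - (z.1 - γ • z.2) = s k - (z.1 - γ • z.2) - lam k • (u k - v k) := by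
    rw [h.s_succ]
    module
  rw [e, norm_sub_sq_real, real_inner_smul_right, norm_smul, mul_pow, Real.norm_eq_abs, sq_abs]
  linarith

lemma antitone_norm_sub (h : IsDRSSequence A B γ lam u v s)
    (hS : SemimonotoneAtSolutions A B μA ρA μB ρB S) (hγ : 0 < γ)
    (hlam : ∀ k, lam k ∈ Ioo 0 (2 * drsAlpha μA ρA μB ρB γ)) {z : E × E} (hz : z ∈ S) :
    Antitone fun k => ‖s k - (z.1 - γ • z.2)‖ := by
  refine antitone_nat_of_succ_le fun k => ?_
  have h1 := h.fejer hS hγ (hlam k).1.le hz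
  have h2 : 0 ≤ lam k * (2 * drsAlpha μA ρA μB ρB γ - lam k) * ‖u k - v k‖ ^ 2 :=
    mul_nonneg (mul_nonneg (hlam k).1.le (sub_nonneg.2 (hlam k).2.le)) (sq_nonneg _)
  exact (sq_le_sq₀ (norm_nonneg _) (norm_nonneg _)).1 (by linarith)

lemma isBounded_range (h : IsDRSSequence A B γ lam u v s)
    (hS : SemimonotoneAtSolutions A B μA ρA μB ρB S) (hγ : 0 < γ)
    (hlam : ∀ k, lam k ∈ Ioo 0 (2 * drsAlpha μA ρA μB ρB γ)) :
    Bornology.IsBounded (range s) := by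
  obtain ⟨z, hz⟩ := hS.nonempty
  refine (Metric.isBounded_closedBall (x := z.1 - γ • z.2)
    (r := ‖s 0 - (z.1 - γ • z.2)‖)).subset ?_
  rintro _ ⟨k, rfl⟩
  rw [Metric.mem_closedBall, dist_eq_norm]
  exact h.antitone_norm_sub hS hγ hlam hz (Nat.zero_le k)

lemma tendsto_sub (h : IsDRSSequence A B γ lam u v s)
    (hS : SemimonotoneAtSolutions A B μA ρA μB ρB S) (hγ : 0 < γ)
    (hlam : ∀ k, lam k ∈ Ioo 0 (2 * drsAlpha μA ρA μB ρB γ))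
    (hlim : 0 < liminf (fun k => lam k * (2 * drsAlpha μA ρA μB ρB γ - lam k)) atTop) :
    Tendsto (fun k => u k - v k) atTop (𝓝 0) := by
  obtain ⟨z, hz⟩ := hS.nonempty
  obtain ⟨c, hc0, hc⟩ := exists_between hlim
  have hbdd : IsBoundedUnder (· ≥ ·) atTop
      (fun k => lam k * (2 * drsAlpha μA ρA μB ρB γ - lam k)) :=
    isBoundedUnder_of ⟨0, fun k => mul_nonneg (hlam k).1.le (sub_nonneg.2 (hlam k).2.le)⟩
  have hev := eventually_lt_of_lt_liminf hc hbdd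
  -- The squared distances to the shadow of `z` converge, so their decrements tend to zero.
  obtain ⟨l, hl⟩ : ∃ l, Tendsto (fun k => ‖s k - (z.1 - γ • z.2)‖ ^ 2) atTop (𝓝 l) :=
    ⟨_, (tendsto_atTop_ciInf (h.antitone_norm_sub hS hγ hlam hz)
      ⟨0, by rintro _ ⟨k, rfl⟩; exact norm_nonneg _⟩).pow 2⟩
  have hd : Tendsto (fun k => c⁻¹ * (‖s k - (z.1 - γ • z.2)‖ ^ 2
      - ‖s (k + 1) - (z.1 - γ • z.2)‖ ^ 2)) atTop (𝓝 0) := by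
    simpa using (hl.sub ((tendsto_add_atTop_iff_nat 1).2 hl)).const_mul c⁻¹
  have hsq : Tendsto (fun k => ‖u k - v k‖ ^ 2) atTop (𝓝 0) := by
    refine squeeze_zero' (Eventually.of_forall fun k => sq_nonneg _) ?_ hd
    filter_upwards [hev] with k hk
    rw [le_inv_mul_iff₀ hc0]
    have h1 := h.fejer hS hγ (hlam k).1.le hz
    have h2 := mul_le_mul_of_nonneg_right hk.le (sq_nonneg ‖u k - v k‖)
    linarith
  rw [tendsto_zero_iff_norm_tendsto_zero]
  simpa [Real.sqrt_sq] using hsq.sqrt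

/-- The best-iterate rate, by telescoping the Fejér-type inequality. -/
lemma inf_norm_sub_sq_le (h : IsDRSSequence A B γ lam u v s)
    (hS : SemimonotoneAtSolutions A B μA ρA μB ρB S) (hγ : 0 < γ)
    (hlam : ∀ k, lam k ∈ Ioo 0 (2 * drsAlpha μA ρA μB ρB γ)) {κ : ℝ} (hκ : 0 < κ)
    (hκlam : ∀ k, κ ≤ lam k * (2 * drsAlpha μA ρA μB ρB γ - lam k)) {z : E × E} (hz : z ∈ S)
    (N : ℕ) :
    (Finset.range (N + 1)).inf' Finset.nonempty_range_add_one (fun k => ‖u k - v k‖ ^ 2)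
      ≤ ‖s 0 - (z.1 - γ • z.2)‖ ^ 2 / ((N + 1) * κ) := by
  have hsum : ∀ M : ℕ, κ * ∑ k ∈ Finset.range M, ‖u k - v k‖ ^ 2
      ≤ ‖s 0 - (z.1 - γ • z.2)‖ ^ 2 - ‖s M - (z.1 - γ • z.2)‖ ^ 2 := by
    intro M
    induction M with
    | zero => simp
    | succ M ih =>
      rw [Finset.sum_range_succ, mul_add]
      have h1 := h.fejer hS hγ (hlam M).1.le hz
      have h2 := mul_le_mul_of_nonneg_right (hκlam M) (sq_nonneg ‖u M - v M‖)
      linarith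
  have hcard := Finset.card_nsmul_le_sum (Finset.range (N + 1)) (fun k => ‖u k - v k‖ ^ 2)
    ((Finset.range (N + 1)).inf' Finset.nonempty_range_add_one (fun k => ‖u k - v k‖ ^ 2))
    (fun k hk => Finset.inf'_le _ hk)
  rw [Finset.card_range, nsmul_eq_mul, Nat.cast_add_one] at hcard
  rw [le_div_iff₀ (by positivity)]
  have h1 := mul_le_mul_of_nonneg_left hcard hκ.le
  have h2 := hsum (N + 1)
  linarith [sq_nonneg ‖s (N + 1) - (z.1 - γ • z.2)‖]

lemma exists_mem_add_eq (h : IsDRSSequence A B γ lam u v s) (hγ : γ ≠ 0) (k : ℕ) :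
    ∃ a ∈ A (u k), ∃ b ∈ B (v k), γ⁻¹ • (u k - v k) = a + b :=
  ⟨_, mem_of_mem_resolvent_scale hγ (h.u_mem k), _, mem_of_mem_resolvent_scale hγ (h.v_mem k),
    by module⟩

/-- Along a subsequence, `u` and `v` have the same limit `z.1`, while the elements of `A (u k)` and
`B (v k)` produced by the resolvents tend to `-z.2` and `z.2`. -/
lemma mem_zer_of_mapClusterPt (h : IsDRSSequence A B γ lam u v s) (hγ : γ ≠ 0)
    (hA : A.OuterSemicontinuous) (hB : B.OuterSemicontinuous)
    (huv : Tendsto (fun k => u k - v k) atTop (𝓝 0)) {z : E × E}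
    (hz : MapClusterPt z atTop fun k => drsPoint γ (u k) (v k) (s k)) :
    z ∈ (SetOp.primalDual A B).zer := by
  obtain ⟨ψ, hψ, hlim⟩ := hz.tendsto_subseq
  have hu : Tendsto (fun k => u (ψ k)) atTop (𝓝 z.1) := (continuous_fst.tendsto z).comp hlim
  have hb : Tendsto (fun k => γ⁻¹ • ((2 : ℝ) • u (ψ k) - s (ψ k) - v (ψ k))) atTop (𝓝 z.2) :=
    (continuous_snd.tendsto z).comp hlim
  have hw : Tendsto (fun k => u (ψ k) - v (ψ k)) atTop (𝓝 0) := huv.comp hψ.tendsto_atTop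
  have hv : Tendsto (fun k => v (ψ k)) atTop (𝓝 z.1) := by simpa using hu.sub hw
  have ha : Tendsto (fun k => γ⁻¹ • (s (ψ k) - u (ψ k))) atTop (𝓝 (-z.2)) := by
    have := (hw.const_smul γ⁻¹).sub hb
    rw [smul_zero, zero_sub] at this
    refine this.congr fun k => ?_
    module
  exact mem_zer_primalDual.2
    ⟨hA _ _ _ _ hu ha fun k => mem_of_mem_resolvent_scale hγ (h.u_mem (ψ k)),
      hB _ _ _ _ hv hb fun k => mem_of_mem_resolvent_scale hγ (h.v_mem (ψ k))⟩

/-! ### Continuous single-valued resolvents -/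

/-- The iterates `u` and `v` are continuous functions of `s`. -/
lemma exists_continuous_of_singleValuedContinuous (h : IsDRSSequence A B γ lam u v s)
    (hJA : (A.scale γ).resolvent.SingleValuedContinuous)
    (hJB : (B.scale γ).resolvent.SingleValuedContinuous) :
    ∃ f g : E → E, Continuous f ∧ Continuous g ∧ (∀ k, u k = f (s k)) ∧ ∀ k, v k = g (s k) := by
  obtain ⟨f, hf, hfA⟩ := hJA
  obtain ⟨g, hg, hgB⟩ := hJB
  have hu : ∀ k, u k = f (s k) := fun k => by simpa [hfA] using h.u_mem k
  have hv : ∀ k, v k = g ((2 : ℝ) • u k - s k) := fun k => by simpa [hgB] using h.v_mem k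
  exact ⟨f, fun t => g ((2 : ℝ) • f t - t), hf, by fun_prop, hu, fun k => by rw [hv, hu]⟩

lemma exists_zer_of_mapClusterPt (h : IsDRSSequence A B γ lam u v s) (hγ : γ ≠ 0)
    (hA : A.OuterSemicontinuous) (hB : B.OuterSemicontinuous)
    (huv : Tendsto (fun k => u k - v k) atTop (𝓝 0))
    (hJA : (A.scale γ).resolvent.SingleValuedContinuous)
    (hJB : (B.scale γ).resolvent.SingleValuedContinuous) {t : E} (ht : MapClusterPt t atTop s) :
    ∃ z ∈ (SetOp.primalDual A B).zer, t = z.1 - γ • z.2 := by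
  obtain ⟨f, g, hf, hg, hu, hv⟩ := h.exists_continuous_of_singleValuedContinuous hJA hJB
  have hfg : f t = g t := by
    obtain ⟨ψ, hψ, hlim⟩ := ht.tendsto_subseq
    have h1 : Tendsto (fun k => u (ψ k) - v (ψ k)) atTop (𝓝 (f t - g t)) := by
      simp only [hu, hv]
      exact ((hf.sub hg).tendsto t).comp hlim
    exact sub_eq_zero.1 (tendsto_nhds_unique h1 (huv.comp hψ.tendsto_atTop))
  have hc : Continuous fun t => drsPoint γ (f t) (g t) t := by
    unfold drsPoint
    fun_prop
  have hz : MapClusterPt (drsPoint γ (f t) (g t) t) atTop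
      fun k => drsPoint γ (u k) (v k) (s k) := by
    simp only [hu, hv]
    exact ht.continuousAt_comp hc.continuousAt
  refine ⟨_, h.mem_zer_of_mapClusterPt hγ hA hB huv hz, ?_⟩
  rw [← hfg, drsPoint, smul_smul, mul_inv_cancel₀ hγ]
  module

/-- If all zeros belong to `S`, then the distance from `s k` to a cluster point of `s` is
nonincreasing, so that the whole sequence converges to it. -/
lemma exists_zer_tendsto [ProperSpace E] (h : IsDRSSequence A B γ lam u v s)
    (hS : SemimonotoneAtSolutions A B μA ρA μB ρB S) (hγ : 0 < γ)
    (hlam : ∀ k, lam k ∈ Ioo 0 (2 * drsAlpha μA ρA μB ρB γ))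
    (hA : A.OuterSemicontinuous) (hB : B.OuterSemicontinuous)
    (huv : Tendsto (fun k => u k - v k) atTop (𝓝 0))
    (hJA : (A.scale γ).resolvent.SingleValuedContinuous)
    (hJB : (B.scale γ).resolvent.SingleValuedContinuous)
    (hSzer : S = (SetOp.primalDual A B).zer) :
    ∃ z ∈ (SetOp.primalDual A B).zer, Tendsto s atTop (𝓝 (z.1 - γ • z.2)) := by
  obtain ⟨t, -, ψ, hψ, hlim⟩ := tendsto_subseq_of_bounded (h.isBounded_range hS hγ hlam)
    (fun k => mem_range_self k)
  have ht : MapClusterPt t atTop s := hlim.mapClusterPt.of_comp hψ.tendsto_atTop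
  obtain ⟨z, hz, rfl⟩ := h.exists_zer_of_mapClusterPt hγ.ne' hA hB huv hJA hJB ht
  refine ⟨z, hz, ?_⟩
  rw [tendsto_iff_norm_sub_tendsto_zero] at hlim ⊢
  exact (tendsto_iff_tendsto_subseq_of_antitone (h.antitone_norm_sub hS hγ hlam (hSzer ▸ hz))
    hψ.tendsto_atTop).2 hlim

lemma exists_zer_tendsto_drsPoint (h : IsDRSSequence A B γ lam u v s) (hγ : γ ≠ 0)
    (hA : A.OuterSemicontinuous) (hB : B.OuterSemicontinuous)
    (huv : Tendsto (fun k => u k - v k) atTop (𝓝 0))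
    (hJA : (A.scale γ).resolvent.SingleValuedContinuous)
    (hJB : (B.scale γ).resolvent.SingleValuedContinuous) {t : E} (ht : Tendsto s atTop (𝓝 t)) :
    ∃ z ∈ (SetOp.primalDual A B).zer,
      Tendsto (fun k => drsPoint γ (u k) (v k) (s k)) atTop (𝓝 z) := by
  obtain ⟨f, g, hf, hg, hu, hv⟩ := h.exists_continuous_of_singleValuedContinuous hJA hJB
  have hc : Continuous fun t => drsPoint γ (f t) (g t) t := by
    unfold drsPoint
    fun_prop
  have hlim : Tendsto (fun k => drsPoint γ (u k) (v k) (s k)) atTop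
      (𝓝 (drsPoint γ (f t) (g t) t)) := by
    simp only [hu, hv]
    exact (hc.tendsto t).comp ht
  exact ⟨_, h.mem_zer_of_mapClusterPt hγ hA hB huv hlim.mapClusterPt, hlim⟩

end IsDRSSequence

end Fejer

/-! ### Convergence of Douglas-Rachford splitting -/

theorem theorem5p2 (n : ℕ) (A B : SetOp (EuclideanSpace ℝ (Fin n)))
    (μA ρA μB ρB : ℝ)
    (S : Set (EuclideanSpace ℝ (Fin n) × EuclideanSpace ℝ (Fin n))) (γ : ℝ)
    (hA : A.OuterSemicontinuous) (hB : B.OuterSemicontinuous)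
    (hS : SemimonotoneAtSolutions A B μA ρA μB ρB S)
    (hAB : ((A.scale γ).resolvent.dom = Set.univ ∧ (B.scale γ).resolvent.dom = Set.univ) ∨
      (A.MaximallySemimonotone μA ρA ∧ B.MaximallySemimonotone μB ρB))
    (hγ : γ ∈ stepsizeRange μA ρA μB ρB) :
    0 < drsAlpha μA ρA μB ρB γ ∧
    ∀ (lam : ℕ → ℝ) (u v s : ℕ → EuclideanSpace ℝ (Fin n)),
      (∀ k, lam k ∈ Set.Ioo 0 (2 * drsAlpha μA ρA μB ρB γ)) →
      0 < liminf (fun k => lam k * (2 * drsAlpha μA ρA μB ρB γ - lam k)) atTop →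
      IsDRSSequence A B γ lam u v s →
      -- either a primal-dual solution is reached after finitely many iterations, or (1)-(4) hold
      ((∃ k, drsPoint γ (u k) (v k) (s k) ∈ (SetOp.primalDual A B).zer) ∨
        -- (1)
        ((∀ k, ∃ a ∈ A (u k), ∃ b ∈ B (v k), γ⁻¹ • (u k - v k) = a + b) ∧
          Tendsto (fun k => u k - v k) atTop (𝓝 0)) ∧
        -- (2)
        (∀ z, MapClusterPt z atTop (fun k => drsPoint γ (u k) (v k) (s k)) →
          z ∈ (SetOp.primalDual A B).zer) ∧
        -- (3)
        Bornology.IsBounded (Set.range s) ∧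
        -- (4)
        (∀ κ : ℝ, 0 < κ → (∀ k, κ ≤ lam k * (2 * drsAlpha μA ρA μB ρB γ - lam k)) →
          ∀ z ∈ S, ∀ N : ℕ,
            (Finset.range (N + 1)).inf' Finset.nonempty_range_add_one
                (fun k => ‖u k - v k‖ ^ 2) ≤
              ‖s 0 - (z.1 - γ • z.2)‖ ^ 2 / ((N + 1) * κ))) ∧
      -- moreover, if both resolvents are single-valued and continuous, (5) and (6) hold
      ((A.scale γ).resolvent.SingleValuedContinuous →
        (B.scale γ).resolvent.SingleValuedContinuous →
        -- (5)
        (∀ t, MapClusterPt t atTop s →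
          ∃ z ∈ (SetOp.primalDual A B).zer, t = z.1 - γ • z.2) ∧
        -- (6)
        (S = (SetOp.primalDual A B).zer →
          (∃ z ∈ (SetOp.primalDual A B).zer, Tendsto s atTop (𝓝 (z.1 - γ • z.2))) ∧
          (∃ z ∈ (SetOp.primalDual A B).zer,
            Tendsto (fun k => drsPoint γ (u k) (v k) (s k)) atTop (𝓝 z)))) := by
  obtain ⟨hγ0, hα⟩ := pos_of_mem_stepsizeRange hS.mu_cond hS.rho_cond hS.prod_cond hγ
  refine ⟨hα, fun lam u v s hlam hlim h => ?_⟩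
  have huv := h.tendsto_sub hS hγ0 hlam hlim
  refine ⟨Or.inr ⟨⟨h.exists_mem_add_eq hγ0.ne', huv⟩,
    fun z hz => h.mem_zer_of_mapClusterPt hγ0.ne' hA hB huv hz, h.isBounded_range hS hγ0 hlam,
    fun κ hκ hκlam z hz N => h.inf_norm_sub_sq_le hS hγ0 hlam hκ hκlam hz N⟩,
    fun hJA hJB => ⟨fun t ht => h.exists_zer_of_mapClusterPt hγ0.ne' hA hB huv hJA hJB ht,
      fun hSzer => ?_⟩⟩
  obtain ⟨z, hz, hs⟩ := h.exists_zer_tendsto hS hγ0 hlam hA hB huv hJA hJB hSzer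
  exact ⟨⟨z, hz, hs⟩, h.exists_zer_tendsto_drsPoint hγ0.ne' hA hB huv hJA hJB hs⟩
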